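/- Let $k\ge 1$ be an integer. Assume Erdős' girth conjecture for $k$: there is a constant $c_0>0$ such that for all sufficiently large $n$ there is a graph on $n$ vertices of girth exactly $2k+2$ with at least $c_0 n^{1+1/k}$ edges. Consider $s$ players, where player $i$ holds an edge set $E_i$ on the common vertex set $[n]$ and the sets $E_1,\dots,E_s$ are pairwise disjoint (no duplication); let $G=([n],\bigcup_i E_i)$. In a randomized simultaneous protocol, each player sends one bit string, depending only on its own edge set and on the (public) coin tosses, to a coordinator, who computes from the received messages and the coin tosses a function $O:[n]\times[n]\to[0,\infty]$. The protocol solves the multiplicative $(2k-1)$-approximate distance oracle problem if, for every input without duplication, with probability at least $2/3$, $$d_G(v,w)\le O(v,w)\le (2k-1)\,d_G(v,w)\qquad\text{for all } v,w\in[n],$$ where $d_G(v,w)=\infty$ if $v$ and $w$ are not connected in $G$. Its cost is the maximum, over all inputs without duplication and all coin tosses, of the total number of bits sent, and the randomized simultaneous communication complexity $R_k(n,s)$ is the infimum of the costs of all protocols that solve the problem. Let $\bar R_k(n,s)$ be the same quantity with the cost of a protocol replaced by the maximum, over all inputs without duplication, of the expected total number of bits sent. Then there is a constant $c>0$ (which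 does not depend on $s$ or $n$) such that for every sequence $s=s(n)$ of non-negative integers with $s(n)=o\bigl(n^{1/3-1/(3k)}\bigr)$ and all sufficiently large $n$, $$R_k(n,s(n))\ \ge\ c\,s(n)\,n^{1+1/k}\qquad\text{and}\qquad \bar R_k(n,s(n))\ \ge\ c\,s(n)\,n^{1+1/k}.$$ -/

import Mathlib

open Filter Asymptotics
open scoped ENNReal

/-- The girth conjecture of Erdős for the parameter `k`: for all large `n` there is a graph on `n`
vertices of girth `2k+2` with `Ω(n^{1+1/k})` edges. -/
def ErdosGirthConjecture (k : ℕ) : Prop :=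
  ∃ c : ℝ, 0 < c ∧ ∀ᶠ n : ℕ in atTop, ∃ G : SimpleGraph (Fin n),
    G.egirth = ((2 * k + 2 : ℕ) : ℕ∞) ∧ c * (n : ℝ) ^ (1 + 1 / (k : ℝ)) ≤ (G.edgeSet.ncard : ℝ)

/-- An input for `s` players: player `i` holds the edge set of the graph `E i`
on the common vertex set `Fin n`. -/
abbrev PlayerInputs (n s : ℕ) : Type := Fin s → SimpleGraph (Fin n)

/-- The model without duplication: the players' edge sets are pairwise disjoint. -/
def WithoutDuplication {n s : ℕ} (E : PlayerInputs n s) : Prop :=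
  ∀ i j : Fin s, i ≠ j → Disjoint (E i).edgeSet (E j).edgeSet

/-- The input graph: its edge set is the union of the players' edge sets. -/
def inputGraph {n s : ℕ} (E : PlayerInputs n s) : SimpleGraph (Fin n) := ⨆ i, E i

/-- The answers of an oracle to all distance queries (`∞` is an allowed answer). -/
abbrev OracleTable (n : ℕ) : Type := Fin n → Fin n → ℝ≥0∞

/-- `O` is a multiplicative `α`-approximate distance oracle for `G`:
`d_G(v,w) ≤ O(v,w) ≤ α * d_G(v,w)`, where `d_G(v,w) = ∞` if `v`, `w` are not connected. -/
def IsApproxDistanceOracle {n : ℕ} (α : ℕ) (G : SimpleGraph (Fin n)) (O : OracleTable n) : Prop :=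
  ∀ v w : Fin n, ((G.edist v w : ℕ∞) : ℝ≥0∞) ≤ O v w ∧
    O v w ≤ (α : ℝ≥0∞) * ((G.edist v w : ℕ∞) : ℝ≥0∞)

/-- A deterministic simultaneous protocol: every player sends one bit string, computed from its own
input alone, to the coordinator, who computes the output from the received messages. -/
structure SimultaneousProtocol (n s : ℕ) where
  message : Fin s → SimpleGraph (Fin n) → List Bool
  output : (Fin s → List Bool) → OracleTable n

namespace SimultaneousProtocol

variable {n s : ℕ}

/-- The coordinator's output on the input `E`. -/
def run (π : SimultaneousProtocol n s) (E : PlayerInputs n s) : OracleTable n :=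
  π.output fun i => π.message i (E i)

/-- The total number of bits sent on the input `E`. -/
def bits (π : SimultaneousProtocol n s) (E : PlayerInputs n s) : ℕ :=
  ∑ i, (π.message i (E i)).length

end SimultaneousProtocol

/-- A randomized simultaneous protocol: a deterministic protocol chosen by coin tosses that all
players and the coordinator see (private coins are the special case in which the
parts of the protocol are chosen independently of each other). -/
abbrev RandomizedSimultaneousProtocol (n s : ℕ) : Type := PMF (SimultaneousProtocol n s)

namespace RandomizedSimultaneousProtocol

variable {n s : ℕ}

/-- The protocol solves the `α`-approximate distance oracle problem without duplication: on every
admissible input it succeeds with probability at least `2/3`. -/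
def Solves (P : RandomizedSimultaneousProtocol n s) (α : ℕ) : Prop :=
  ∀ E : PlayerInputs n s, WithoutDuplication E →
    2 / 3 ≤ PMF.toOuterMeasure P {π | IsApproxDistanceOracle α (inputGraph E) (π.run E)}

/-- Worst-case cost: the largest total number of bits over all admissible inputs and all
coin tosses. -/
noncomputable def worstCaseCost (P : RandomizedSimultaneousProtocol n s) : ℝ≥0∞ :=
  ⨆ (E : PlayerInputs n s) (_ : WithoutDuplication E),
    ⨆ π ∈ PMF.support P, ((π.bits E : ℕ) : ℝ≥0∞)

/-- Expected cost: the largest expected total number of bits over all admissible inputs. -/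
noncomputable def expectedCost (P : RandomizedSimultaneousProtocol n s) : ℝ≥0∞ :=
  ⨆ (E : PlayerInputs n s) (_ : WithoutDuplication E),
    ∑' π : SimultaneousProtocol n s, P π * ((π.bits E : ℕ) : ℝ≥0∞)

end RandomizedSimultaneousProtocol

/-- The randomized simultaneous communication complexity of the `α`-approximate distance oracle
problem without duplication, for `s` players and graphs on `n` vertices. -/
noncomputable def simultaneousComplexity (α n s : ℕ) : ℝ≥0∞ :=
  ⨅ (P : RandomizedSimultaneousProtocol n s) (_ : P.Solves α), P.worstCaseCost

/-- The same with the expected instead of the worst-case number of bits. -/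
noncomputable def expectedSimultaneousComplexity (α n s : ℕ) : ℝ≥0∞ :=
  ⨅ (P : RandomizedSimultaneousProtocol n s) (_ : P.Solves α), P.expectedCost

/-! ### Approximate distances in subgraphs of a graph of large girth -/

/-! Deleting an edge from a graph `G` of girth at least 2k+2 leaves its endpoints at distance at
least 2k+1, so a (2k-1)-approximate oracle for a subgraph of `G` determines that subgraph
(`IsApproxDistanceOracle.graph_unique`). If one player alone holds a subgraph of `G`, its message
must therefore encode nearly arbitrary subsets of the edges, and for some subgraph its expected
length is linear in the number of edges (`exists_le_expected_length`). A message depends only on its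
sender's input, so the hard subgraphs of all players can be put into one input, where the expected
lengths add up. Edge-disjointness of that input comes from packing `s` large pieces of permuted
copies of one extremal graph into the complete graph (`SimpleGraph.exists_disjoint_copies`). The
worst-case bound follows from the bound on expected cost. -/

theorem le_edist_of_le_egirth {V : Type*} {k : ℕ} {G H : SimpleGraph V}
    (hG : ((2 * k + 2 : ℕ) : ℕ∞) ≤ G.egirth) (hHG : H ≤ G) {v w : V}
    (hGvw : G.Adj v w) (hHvw : ¬ H.Adj v w) : ((2 * k + 1 : ℕ) : ℕ∞) ≤ H.edist v w := by
  classical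
  by_contra! hlt
  obtain ⟨p, hp⟩ := SimpleGraph.exists_walk_of_edist_ne_top hlt.ne_top
  rw [← hp] at hlt
  have hlen : p.bypass.length < 2 * k + 1 :=
    lt_of_le_of_lt p.length_bypass_le_length (by exact_mod_cast hlt)
  -- The edge `vw` is not in `H`, so it closes a short path of `H` to a cycle of `G` of length at
  -- most 2k+1.
  have hcycle : (SimpleGraph.Walk.cons hGvw.symm (p.bypass.mapLe hHG)).IsCycle := by
    rw [SimpleGraph.Walk.cons_isCycle_iff]
    refine ⟨(SimpleGraph.Walk.isPath_mapLe hHG).2 p.bypass_isPath, fun hmem => ?_⟩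
    rw [SimpleGraph.Walk.edges_mapLe_eq_edges] at hmem
    exact hHvw (SimpleGraph.Walk.adj_of_mem_edges _ hmem).symm
  have hle := hG.trans (SimpleGraph.egirth_le_length hcycle)
  simp only [SimpleGraph.Walk.length_cons, SimpleGraph.Walk.length_map,
    SimpleGraph.Walk.mapLe, Nat.cast_le] at hle
  omega

theorem IsApproxDistanceOracle.adj_iff {n k : ℕ} (hk : 1 ≤ k) {G H : SimpleGraph (Fin n)}
    (hG : ((2 * k + 2 : ℕ) : ℕ∞) ≤ G.egirth) (hHG : H ≤ G) {O : OracleTable n}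
    (hO : IsApproxDistanceOracle (2 * k - 1) H O) (v w : Fin n) :
    H.Adj v w ↔ G.Adj v w ∧ O v w ≤ ((2 * k - 1 : ℕ) : ℝ≥0∞) := by
  constructor
  · intro h
    refine ⟨hHG h, ?_⟩
    simpa [SimpleGraph.edist_eq_one_iff_adj.2 h] using (hO v w).2
  · rintro ⟨hGvw, hle⟩
    by_contra hHvw
    have h1 := le_edist_of_le_egirth hG hHG hGvw hHvw
    have h2 : ((2 * k + 1 : ℕ) : ℝ≥0∞) ≤ ((H.edist v w : ℕ∞) : ℝ≥0∞) := by
      exact_mod_cast ENat.toENNReal_le.2 h1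
    have h3 := h2.trans ((hO v w).1.trans hle)
    rw [Nat.cast_le] at h3
    omega

theorem IsApproxDistanceOracle.graph_unique {n k : ℕ} (hk : 1 ≤ k) {G H H' : SimpleGraph (Fin n)}
    (hG : ((2 * k + 2 : ℕ) : ℕ∞) ≤ G.egirth) (hHG : H ≤ G) (hHG' : H' ≤ G) {O : OracleTable n}
    (hO : IsApproxDistanceOracle (2 * k - 1) H O)
    (hO' : IsApproxDistanceOracle (2 * k - 1) H' O) : H = H' := by
  ext v w
  rw [hO.adj_iff hk hG hHG, hO'.adj_iff hk hG hHG']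

/-! ### Packing permuted copies of a graph -/

theorem Sym2.exists_perm_map_eq {V : Type*} [DecidableEq V] {e f : Sym2 V}
    (he : ¬ e.IsDiag) (hf : ¬ f.IsDiag) : ∃ σ : Equiv.Perm V, Sym2.map σ e = f := by
  induction e with | _ a b => ?_
  induction f with | _ c d => ?_
  rw [Sym2.mk_isDiag_iff] at he hf
  -- The first swap sends `a` to `c`; the second moves the image of `b` to `d` and fixes `c`.
  refine ⟨Equiv.swap (Equiv.swap a c b) d * Equiv.swap a c, ?_⟩
  have hc : c ≠ Equiv.swap a c b := by
    intro h
    apply he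
    rw [← (Equiv.swap a c).apply_eq_iff_eq, Equiv.swap_apply_left]
    exact h
  simp [Equiv.swap_apply_of_ne_of_ne hc hf]

/-- Left multiplication by a permutation taking `f` to `f'` is a bijection between the fibres over
`f` and `f'`, so the disjoint fibres over all non-loops have equal size. -/
theorem Sym2.card_perm_map_eq_mul_choose_le {V : Type*} [Fintype V] [DecidableEq V]
    (e : Sym2 V) {f : Sym2 V} (hf : ¬ f.IsDiag) :
    (Finset.univ.filter fun σ : Equiv.Perm V => Sym2.map σ e = f).card *
      (Fintype.card V).choose 2 ≤ Fintype.card (Equiv.Perm V) := by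
  rw [← SimpleGraph.card_edgeFinset_top_eq_card_choose_two, mul_comm, ← smul_eq_mul,
    ← Finset.sum_const]
  calc
    _ = ∑ f' ∈ (⊤ : SimpleGraph V).edgeFinset,
        (Finset.univ.filter fun σ : Equiv.Perm V => Sym2.map σ e = f').card := by
      refine Finset.sum_congr rfl fun f' hf' => ?_
      have hf'' : ¬ f'.IsDiag := by simpa using hf'
      obtain ⟨τ, hτ⟩ := Sym2.exists_perm_map_eq hf hf''
      refine Finset.card_bij (fun σ _ => τ * σ) ?_ ?_ ?_
      · intro σ hσ
        simp only [Finset.mem_filter, Finset.mem_univ, true_and] at hσ ⊢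
        rw [Equiv.Perm.coe_mul, ← Sym2.map_map, hσ, hτ]
      · intro σ _ σ' _ h
        exact mul_left_cancel h
      · intro σ hσ
        simp only [Finset.mem_filter, Finset.mem_univ, true_and] at hσ
        refine ⟨τ⁻¹ * σ, ?_, by simp⟩
        simp only [Finset.mem_filter, Finset.mem_univ, true_and]
        rw [Equiv.Perm.coe_mul, ← Sym2.map_map, hσ, ← hτ, Sym2.map_map]
        simp
    _ = (Finset.univ.filter fun σ : Equiv.Perm V =>
        Sym2.map σ e ∈ (⊤ : SimpleGraph V).edgeFinset).card := by
      rw [Finset.card_eq_sum_card_fiberwise (f := fun σ : Equiv.Perm V => Sym2.map σ e)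
        (t := (⊤ : SimpleGraph V).edgeFinset)]
      · refine Finset.sum_congr rfl fun f' hf' => ?_
        congr 1
        ext σ
        simp only [Finset.mem_filter, Finset.mem_univ, true_and]
        constructor
        · rintro rfl
          exact ⟨hf', rfl⟩
        · exact fun h => h.2
      · intro σ hσ
        exact (Finset.mem_filter.1 hσ).2
    _ ≤ _ := Finset.card_le_univ _

/-- First-moment bound: a uniformly random permutation takes a given `e` to a given `f ∈ B` with
probability at most one over `choose 2`. -/
theorem Sym2.exists_perm_card_filter_mul_choose_le {V : Type*} [Fintype V] [DecidableEq V]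
    (A B : Finset (Sym2 V)) (hB : ∀ f ∈ B, ¬ f.IsDiag) :
    ∃ σ : Equiv.Perm V, (A.filter fun e => Sym2.map σ e ∈ B).card * (Fintype.card V).choose 2 ≤
      A.card * B.card := by
  have hsum : ∑ σ : Equiv.Perm V,
      (A.filter fun e => Sym2.map σ e ∈ B).card * (Fintype.card V).choose 2 ≤
      ∑ _σ : Equiv.Perm V, A.card * B.card := by
    calc
      _ = ∑ e ∈ A, ∑ f ∈ B, (Finset.univ.filter fun σ : Equiv.Perm V => Sym2.map σ e = f).card *
          (Fintype.card V).choose 2 := by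
        simp_rw [← Finset.sum_mul]
        congr 1
        simp_rw [Finset.card_filter]
        rw [Finset.sum_comm]
        refine Finset.sum_congr rfl fun e _ => ?_
        rw [Finset.sum_comm]
        refine Finset.sum_congr rfl fun σ _ => ?_
        simp
      _ ≤ ∑ e ∈ A, ∑ f ∈ B, Fintype.card (Equiv.Perm V) :=
        Finset.sum_le_sum fun e _ => Finset.sum_le_sum fun f hf =>
          Sym2.card_perm_map_eq_mul_choose_le e (hB f hf)
      _ = _ := by
        simp only [Finset.sum_const, smul_eq_mul, Finset.card_univ]
        ring
  obtain ⟨σ, -, hσ⟩ := Finset.exists_le_of_sum_le Finset.univ_nonempty hsum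
  exact ⟨σ, hσ⟩

/-- Greedy packing: take a permuted copy of `G` with few collisions and delete its edges that are
already used. Deletion cannot lower the girth. -/
theorem SimpleGraph.exists_disjoint_copies {V : Type*} [Fintype V] {g : ℕ∞} {G : SimpleGraph V}
    (hG : g ≤ G.egirth) {s : ℕ} (hs : 2 * s * G.edgeSet.ncard ≤ (Fintype.card V).choose 2) :
    ∃ F : Fin s → SimpleGraph V, (∀ i j, i ≠ j → Disjoint (F i).edgeSet (F j).edgeSet) ∧
      ∀ i, g ≤ (F i).egirth ∧ (F i).edgeSet.ncard ≤ G.edgeSet.ncard ∧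
        G.edgeSet.ncard ≤ 2 * (F i).edgeSet.ncard := by
  classical
  induction s with
  | zero => exact ⟨fun i => i.elim0, fun i => i.elim0, fun i => i.elim0⟩
  | succ t ih =>
    obtain ⟨F, hdisj, hF⟩ := ih (le_trans (by gcongr; omega) hs)
    set B : Finset (Sym2 V) := Finset.univ.biUnion fun i => (F i).edgeFinset with hBdef
    have hB : ∀ f ∈ B, ¬ f.IsDiag := by
      intro f hf
      obtain ⟨i, -, hi⟩ := Finset.mem_biUnion.1 hf
      exact SimpleGraph.not_isDiag_of_mem_edgeFinset hi
    have hBcard : B.card ≤ t * G.edgeSet.ncard := by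
      refine Finset.card_biUnion_le.trans ?_
      calc
        _ ≤ ∑ _i : Fin t, G.edgeSet.ncard := Finset.sum_le_sum fun i _ => by
              rw [← Set.ncard_coe_finset, SimpleGraph.coe_edgeFinset]
              exact (hF i).2.1
        _ = _ := by simp
    obtain ⟨σ, hσ⟩ := Sym2.exists_perm_card_filter_mul_choose_le G.edgeFinset B hB
    set G' : SimpleGraph V := G.map σ.toEmbedding with hG'
    have hG'edge : G'.edgeSet = Sym2.map σ '' G.edgeSet := by
      rw [hG', SimpleGraph.edgeSet_map]; rfl
    have hinj : Function.Injective (Sym2.map σ) := Sym2.map.injective σ.injective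
    have hG'card : G'.edgeSet.ncard = G.edgeSet.ncard := by
      rw [hG'edge, Set.ncard_image_of_injective _ hinj]
    have hGcard : G.edgeFinset.card = G.edgeSet.ncard := by
      rw [← Set.ncard_coe_finset, SimpleGraph.coe_edgeFinset]
    set D : SimpleGraph V := G'.deleteEdges B with hD
    have hDedge : D.edgeSet = G'.edgeSet \ B := SimpleGraph.edgeSet_deleteEdges _
    have hinter : (G'.edgeSet ∩ B).ncard =
        (G.edgeFinset.filter fun e => Sym2.map σ e ∈ B).card := by
      rw [← Set.ncard_coe_finset (G.edgeFinset.filter _),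
        ← Set.ncard_image_of_injective (G.edgeFinset.filter _ : Set (Sym2 V)) hinj]
      congr 1
      ext f
      rw [hG'edge]
      constructor
      · rintro ⟨⟨e, he, rfl⟩, hf⟩
        exact ⟨e, Finset.mem_coe.2 (Finset.mem_filter.2
          ⟨SimpleGraph.mem_edgeFinset.2 he, Finset.mem_coe.1 hf⟩), rfl⟩
      · rintro ⟨e, he, rfl⟩
        have he' := Finset.mem_filter.1 (Finset.mem_coe.1 he)
        exact ⟨⟨e, SimpleGraph.mem_edgeFinset.1 he'.1, rfl⟩, Finset.mem_coe.2 he'.2⟩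
    have hadd := Set.ncard_inter_add_ncard_sdiff_eq_ncard G'.edgeSet (B : Set (Sym2 V))
      (Set.toFinite _)
    rw [hinter, ← hDedge, hG'card] at hadd
    -- With m edges in `G`, at most tm are used so far, so the collisions number at most m · tm /
    -- (2(t+1)m) < m/2.
    have hhalf : 2 * (G.edgeFinset.filter fun e => Sym2.map σ e ∈ B).card ≤ G.edgeSet.ncard := by
      rcases Nat.eq_zero_or_pos G.edgeSet.ncard with h0 | hpos
      · omega
      · rw [hGcard] at hσ
        have h1 := (Nat.mul_le_mul_left _ hs).trans (hσ.trans (Nat.mul_le_mul_left _ hBcard))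
        by_contra! hlt
        have h2 : (t + 1) * (G.edgeSet.ncard * G.edgeSet.ncard) ≤
            t * (G.edgeSet.ncard * G.edgeSet.ncard) := by
          calc
            _ ≤ (t + 1) * (G.edgeSet.ncard *
                (2 * (G.edgeFinset.filter fun e => Sym2.map σ e ∈ B).card)) := by gcongr
            _ = (G.edgeFinset.filter fun e => Sym2.map σ e ∈ B).card *
                (2 * (t + 1) * G.edgeSet.ncard) := by ring
            _ ≤ G.edgeSet.ncard * (t * G.edgeSet.ncard) := h1
            _ = _ := by ring
        have h3 : 0 < G.edgeSet.ncard * G.edgeSet.ncard := Nat.mul_pos hpos hpos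
        nlinarith
    have hDF : ∀ i, Disjoint D.edgeSet (F i).edgeSet := by
      intro i
      rw [hDedge, Set.disjoint_left]
      rintro f ⟨-, hf⟩ hfi
      exact hf (Finset.mem_coe.2 (Finset.mem_biUnion.2
        ⟨i, Finset.mem_univ _, SimpleGraph.mem_edgeFinset.2 hfi⟩))
    refine ⟨Fin.cons D F, ?_, ?_⟩
    · intro i j hij
      cases i using Fin.cases with
      | zero =>
        cases j using Fin.cases with
        | zero => exact absurd rfl hij
        | succ j => simpa using hDF j
      | succ i =>
        cases j using Fin.cases with
        | zero => simpa using (hDF i).symm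
        | succ j => simpa using hdisj i j fun h => hij (congrArg _ h)
    · intro i
      cases i using Fin.cases with
      | zero =>
        simp only [Fin.cons_zero]
        refine ⟨?_, by omega, by omega⟩
        calc
          g ≤ G.egirth := hG
          _ = G'.egirth := (SimpleGraph.Iso.map σ G).egirth_eq
          _ ≤ D.egirth := SimpleGraph.egirth_anti (SimpleGraph.deleteEdges_le _)
      | succ i => simpa using hF i

/-! ### Message lengths -/

theorem List.card_filter_length_lt_add_one_le {α : Type*} (A : Finset α) (f : α → List Bool)
    (hf : Set.InjOn f A) (t : ℕ) : (A.filter fun a => (f a).length < t).card + 1 ≤ 2 ^ t := by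
  classical
  induction t with
  | zero => simp
  | succ t ih =>
    have hlevel : (A.filter fun a => (f a).length = t).card ≤ 2 ^ t := by
      rw [← Fintype.card_bool, ← card_vector t, ← Finset.card_attach]
      refine (Finset.card_le_card_of_injOn
        (fun a => (⟨f a.1, (Finset.mem_filter.1 a.2).2⟩ : List.Vector Bool t))
        (fun _ _ => Finset.mem_coe.2 (Finset.mem_univ _)) ?_)
      intro a _ b _ hab
      exact Subtype.ext (hf (Finset.mem_filter.1 a.2).1 (Finset.mem_filter.1 b.2).1
        (congrArg Subtype.val hab))
    have hsplit : (A.filter fun a => (f a).length < t + 1) =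
        (A.filter fun a => (f a).length < t) ∪ (A.filter fun a => (f a).length = t) := by
      ext a
      simp only [Finset.mem_union, Finset.mem_filter]
      grind
    have := Finset.card_union_le (A.filter fun a => (f a).length < t)
      (A.filter fun a => (f a).length = t)
    rw [hsplit, pow_succ]
    omega

/-- Fewer than `2 ^ t`, hence at most a quarter of `S`, of the elements of `A` have strings shorter
than `t`; each other element of `A` contributes at least `t`. -/
theorem List.four_mul_mul_card_le_sum_length {α : Type*} (S A : Finset α) (hAS : A ⊆ S)
    (f : α → List Bool) (hf : Set.InjOn f A) {t : ℕ} (hS : 2 ^ (t + 2) ≤ S.card) :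
    4 * t * A.card ≤ 4 * ∑ a ∈ S, (f a).length + t * S.card := by
  have hshort : 4 * (A.filter fun a => (f a).length < t).card ≤ S.card := by
    have := List.card_filter_length_lt_add_one_le A f hf t
    rw [pow_add] at hS
    omega
  have hlong : (A.filter fun a => ¬ (f a).length < t).card * t ≤ ∑ a ∈ S, (f a).length := by
    rw [← smul_eq_mul, ← Finset.sum_const]
    calc
      _ ≤ ∑ a ∈ A.filter (fun a => ¬ (f a).length < t), (f a).length :=
        Finset.sum_le_sum fun a ha => not_lt.1 (Finset.mem_filter.1 ha).2
      _ ≤ _ := Finset.sum_le_sum_of_subset ((Finset.filter_subset _ _).trans hAS)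
  have hcard := Finset.card_filter_add_card_filter_not (s := A) fun a => (f a).length < t
  rw [← hcard]
  nlinarith

theorem SimpleGraph.two_pow_ncard_edgeSet_le_card_le {V : Type*} [Fintype V] (G : SimpleGraph V)
    (S : Finset (SimpleGraph V)) (hS : ∀ H, H ∈ S ↔ H ≤ G) : 2 ^ G.edgeSet.ncard ≤ S.card := by
  classical
  rw [← SimpleGraph.coe_edgeFinset, Set.ncard_coe_finset, ← Finset.card_powerset]
  refine Finset.card_le_card_of_injOn (fun D => SimpleGraph.fromEdgeSet (D : Set (Sym2 V))) ?_ ?_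
  · intro D hD
    rw [Finset.mem_coe, Finset.mem_powerset] at hD
    rw [Finset.mem_coe, hS]
    intro v w hvw
    rw [SimpleGraph.fromEdgeSet_adj] at hvw
    exact SimpleGraph.mem_edgeFinset.1 (hD (Finset.mem_coe.1 hvw.1))
  · have key : ∀ D ∈ G.edgeFinset.powerset,
        (SimpleGraph.fromEdgeSet (D : Set (Sym2 V))).edgeSet = D := by
      intro D hD
      rw [Finset.mem_powerset] at hD
      rw [SimpleGraph.edgeSet_fromEdgeSet]
      refine sdiff_eq_left.2 (Set.disjoint_left.2 fun e he hdiag => ?_)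
      exact SimpleGraph.not_isDiag_of_mem_edgeFinset (hD (Finset.mem_coe.1 he)) hdiag
    intro D hD D' hD' h
    rw [← Finset.coe_inj, ← key D hD, ← key D' hD']
    exact congrArg SimpleGraph.edgeSet h

/-! ### Cost of one player's message, and of all messages together -/

/-- The input in which player `i` holds `H` and all other players hold no edges. -/
def loneInput {n s : ℕ} (i : Fin s) (H : SimpleGraph (Fin n)) : PlayerInputs n s :=
  Function.update (fun _ => ⊥) i H

theorem loneInput_withoutDuplication {n s : ℕ} (i : Fin s) (H : SimpleGraph (Fin n)) :
    WithoutDuplication (loneInput i H) := by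
  intro j l hjl
  by_cases hj : j = i
  · subst hj
    simp [loneInput, Function.update_of_ne (Ne.symm hjl)]
  · simp [loneInput, Function.update_of_ne hj]

theorem inputGraph_loneInput {n s : ℕ} (i : Fin s) (H : SimpleGraph (Fin n)) :
    inputGraph (loneInput i H) = H := by
  refine le_antisymm (iSup_le fun j => ?_) (le_iSup_of_le i (by simp [loneInput]))
  by_cases hj : j = i
  · subst hj
    simp [loneInput]
  · simp [loneInput, Function.update_of_ne hj]

theorem SimultaneousProtocol.run_loneInput_congr {n s : ℕ} (π : SimultaneousProtocol n s)
    (i : Fin s) {H H' : SimpleGraph (Fin n)} (h : π.message i H = π.message i H') :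
    π.run (loneInput i H) = π.run (loneInput i H') := by
  unfold SimultaneousProtocol.run
  congr 1
  funext j
  by_cases hj : j = i
  · subst hj
    simpa [loneInput] using h
  · simp [loneInput, Function.update_of_ne hj]

/-- Average over all subgraphs `H` of `G`. For fixed coins the message is injective on the `H`
answered correctly, which on average are at least 2/3 of all; the mean length is thus at least (2/3
- 1/4)t = 5t/12. -/
theorem RandomizedSimultaneousProtocol.exists_le_expected_length {n s k t : ℕ} (hk : 1 ≤ k)
    (P : RandomizedSimultaneousProtocol n s) (hP : P.Solves (2 * k - 1)) (i : Fin s)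
    {G : SimpleGraph (Fin n)} (hG : ((2 * k + 2 : ℕ) : ℕ∞) ≤ G.egirth)
    (ht : t + 2 ≤ G.edgeSet.ncard) :
    ∃ H ≤ G, (5 * t : ℝ≥0∞) ≤
      12 * ∑' π : SimultaneousProtocol n s, P π * ((π.message i H).length : ℝ≥0∞) := by
  classical
  set S : Finset (SimpleGraph (Fin n)) := Finset.univ.filter (· ≤ G) with hSdef
  have hS : ∀ H, H ∈ S ↔ H ≤ G := fun H => by simp [hSdef]
  have hScard : 2 ^ (t + 2) ≤ S.card :=
    (Nat.pow_le_pow_right two_pos ht).trans (G.two_pow_ncard_edgeSet_le_card_le S hS)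
  set good : SimultaneousProtocol n s → SimpleGraph (Fin n) → Prop := fun π H =>
    IsApproxDistanceOracle (2 * k - 1) H (π.run (loneInput i H)) with hgood
  have hdet : ∀ π : SimultaneousProtocol n s,
      (4 * t : ℝ≥0∞) * ((S.filter (good π)).card : ℝ≥0∞) ≤
        4 * ∑ H ∈ S, ((π.message i H).length : ℝ≥0∞) + t * S.card := by
    intro π
    have hinj : Set.InjOn (π.message i) (S.filter (good π) : Finset _) := by
      intro H hH H' hH' h
      rw [Finset.mem_coe, Finset.mem_filter, hS] at hH hH'
      refine IsApproxDistanceOracle.graph_unique hk hG hH.1 hH'.1 hH.2 ?_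
      rw [π.run_loneInput_congr i h]
      exact hH'.2
    exact_mod_cast List.four_mul_mul_card_le_sum_length S _ (Finset.filter_subset _ _) _ hinj hScard
  have hprob : ∀ H ∈ S, 2 / 3 ≤ ∑' π, P π * (if good π H then 1 else 0 : ℝ≥0∞) := by
    intro H _
    have := hP (loneInput i H) (loneInput_withoutDuplication i H)
    rw [inputGraph_loneInput, PMF.toOuterMeasure_apply] at this
    refine this.trans (le_of_eq (tsum_congr fun π => ?_))
    by_cases hπ : good π H
    · rw [Set.indicator_of_mem (by exact hπ), if_pos hπ, mul_one]
    · rw [Set.indicator_of_notMem (by exact hπ), if_neg hπ, mul_zero]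
  have hmain : (4 * t : ℝ≥0∞) * (S.card * (2 / 3)) ≤
      4 * (∑ H ∈ S, ∑' π : SimultaneousProtocol n s, P π * ((π.message i H).length : ℝ≥0∞)) +
        t * S.card := by
    calc
      _ ≤ (4 * t : ℝ≥0∞) * ∑ H ∈ S, ∑' π, P π * (if good π H then 1 else 0 : ℝ≥0∞) := by
        gcongr
        rw [← nsmul_eq_mul]
        exact Finset.card_nsmul_le_sum _ _ _ hprob
      _ = ∑' π, P π * ((4 * t : ℝ≥0∞) * ((S.filter (good π)).card : ℝ≥0∞)) := by
        rw [← Summable.tsum_finsetSum fun _ _ => ENNReal.summable, ← ENNReal.tsum_mul_left]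
        refine tsum_congr fun π => ?_
        rw [← Finset.mul_sum, Finset.sum_boole]
        ring
      _ ≤ ∑' π, P π * (4 * ∑ H ∈ S, ((π.message i H).length : ℝ≥0∞) + t * S.card) :=
        ENNReal.tsum_le_tsum fun π => by gcongr; exact hdet π
      _ = _ := by
        simp_rw [mul_add]
        rw [ENNReal.tsum_add, ENNReal.tsum_mul_right, P.tsum_coe, one_mul,
          ← Summable.tsum_finsetSum fun _ _ => ENNReal.summable, ← ENNReal.tsum_mul_left]
        congr 1
        refine tsum_congr fun π => ?_
        rw [← Finset.mul_sum]
        ring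
  have hne : S.Nonempty := ⟨⊥, (hS _).2 bot_le⟩
  have hfin : (3 * (t * S.card) : ℝ≥0∞) ≠ ⊤ := by finiteness
  have hsum : ∑ _H ∈ S, (5 * t : ℝ≥0∞) ≤ ∑ H ∈ S,
      12 * ∑' π : SimultaneousProtocol n s, P π * ((π.message i H).length : ℝ≥0∞) := by
    rw [Finset.sum_const, nsmul_eq_mul, ← Finset.mul_sum]
    -- Adding the finite term to both sides replaces a subtraction in `ℝ≥0∞`.
    refine (ENNReal.add_le_add_iff_right hfin).1 ?_
    have h3 : (3 : ℝ≥0∞) * (2 / 3) = 2 := ENNReal.mul_div_cancel (by norm_num) (by norm_num)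
    calc
      (S.card * (5 * t) + 3 * (t * S.card) : ℝ≥0∞) = 4 * t * S.card * 2 := by ring
      _ = 4 * t * S.card * (3 * (2 / 3)) := by rw [h3]
      _ = 3 * ((4 * t : ℝ≥0∞) * (S.card * (2 / 3))) := by ring
      _ ≤ _ := mul_le_mul_right hmain 3
      _ = _ := by ring
  obtain ⟨H, hH, hle⟩ := ENNReal.exists_le_of_sum_le hne hsum
  exact ⟨H, (hS H).1 hH, hle⟩

theorem RandomizedSimultaneousProtocol.expectedCost_le_worstCaseCost {n s : ℕ}
    (P : RandomizedSimultaneousProtocol n s) : P.expectedCost ≤ P.worstCaseCost := by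
  refine iSup₂_mono fun E _ => ?_
  calc
    _ ≤ ∑' π, P π * ⨆ π ∈ PMF.support P, ((π.bits E : ℕ) : ℝ≥0∞) := by
      refine ENNReal.tsum_le_tsum fun π => ?_
      by_cases hπ : π ∈ PMF.support P
      · gcongr
        exact le_iSup₂ (f := fun (π : SimultaneousProtocol n s) (_ : π ∈ PMF.support P) =>
          ((π.bits E : ℕ) : ℝ≥0∞)) π hπ
      · rw [PMF.apply_eq_zero_iff P π |>.2 hπ]
        simp
    _ = _ := by rw [ENNReal.tsum_mul_right, P.tsum_coe, one_mul]

theorem expectedSimultaneousComplexity_le_simultaneousComplexity (α n s : ℕ) :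
    expectedSimultaneousComplexity α n s ≤ simultaneousComplexity α n s :=
  iInf₂_mono fun P _ => P.expectedCost_le_worstCaseCost

/-- Correctness is used only on lone inputs, whereas the cost is evaluated on the joint input `E` of
the hard subgraphs, where each player sends the same message as before. -/
theorem mul_le_expectedSimultaneousComplexity {n s k t : ℕ} (hk : 1 ≤ k)
    {F : Fin s → SimpleGraph (Fin n)}
    (hdisj : ∀ i j, i ≠ j → Disjoint (F i).edgeSet (F j).edgeSet)
    (hF : ∀ i, ((2 * k + 2 : ℕ) : ℕ∞) ≤ (F i).egirth) (ht : ∀ i, t + 2 ≤ (F i).edgeSet.ncard) :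
    (s * (5 * t) : ℝ≥0∞) ≤ 12 * expectedSimultaneousComplexity (2 * k - 1) n s := by
  rw [expectedSimultaneousComplexity, ENNReal.mul_iInf_of_ne (by norm_num) (by norm_num)]
  refine le_iInf fun P => ?_
  by_cases hP : P.Solves (2 * k - 1)
  swap
  · simp [hP]
  simp only [hP, iInf_pos]
  choose E hEF hE using fun i => P.exists_le_expected_length hk hP i (hF i) (ht i)
  have hEdisj : WithoutDuplication E := fun i j hij =>
    (hdisj i j hij).mono (SimpleGraph.edgeSet_mono (hEF i)) (SimpleGraph.edgeSet_mono (hEF j))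
  calc
    (s * (5 * t) : ℝ≥0∞) = ∑ _i : Fin s, (5 * t : ℝ≥0∞) := by simp
    _ ≤ ∑ i, 12 * ∑' π : SimultaneousProtocol n s,
        P π * ((π.message i (E i)).length : ℝ≥0∞) := Finset.sum_le_sum fun i _ => hE i
    _ = 12 * ∑' π : SimultaneousProtocol n s, P π * ((π.bits E : ℕ) : ℝ≥0∞) := by
      rw [← Finset.mul_sum, ← Summable.tsum_finsetSum fun _ _ => ENNReal.summable]
      simp_rw [SimultaneousProtocol.bits, Nat.cast_sum, Finset.mul_sum]
    _ ≤ 12 * P.expectedCost := by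
      gcongr
      exact le_iSup₂ (f := fun (E : PlayerInputs n s) (_ : WithoutDuplication E) =>
        ∑' π : SimultaneousProtocol n s, P π * ((π.bits E : ℕ) : ℝ≥0∞)) E hEdisj

/-! ### The lower bound -/

theorem SimpleGraph.exists_le_ncard_edgeSet_eq {V : Type*} [Finite V] (G : SimpleGraph V) {m : ℕ}
    (hm : m ≤ G.edgeSet.ncard) : ∃ H ≤ G, H.edgeSet.ncard = m := by
  obtain ⟨D, hD, hcard⟩ := Set.exists_subset_card_eq hm
  have hedge : (SimpleGraph.fromEdgeSet D).edgeSet = D := by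
    rw [SimpleGraph.edgeSet_fromEdgeSet]
    exact sdiff_eq_left.2 (Set.disjoint_left.2 fun e he hdiag =>
      SimpleGraph.not_isDiag_of_mem_edgeSet _ (hD he) hdiag)
  refine ⟨SimpleGraph.fromEdgeSet D, ?_, by rw [hedge, hcard]⟩
  rw [← SimpleGraph.edgeSet_subset_edgeSet, hedge]
  exact hD

theorem mul_ncard_le_expectedSimultaneousComplexity {n s k m : ℕ} (hk : 1 ≤ k)
    {G : SimpleGraph (Fin n)} (hG : ((2 * k + 2 : ℕ) : ℕ∞) ≤ G.egirth)
    (hm : G.edgeSet.ncard = m) (hm8 : 8 ≤ m) (hs : 2 * s * m ≤ n.choose 2) :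
    ((s * m : ℕ) : ℝ≥0∞) ≤ 12 * expectedSimultaneousComplexity (2 * k - 1) n s := by
  obtain ⟨F, hdisj, hF⟩ := SimpleGraph.exists_disjoint_copies hG (s := s)
    (by rwa [hm, Fintype.card_fin])
  have hle := mul_le_expectedSimultaneousComplexity (t := (m + 1) / 2 - 2) hk hdisj
    (fun i => (hF i).1) fun i => by
      have := (hF i).2.2
      omega
  refine le_trans ?_ hle
  -- Each packed graph keeps at least ⌈m/2⌉ edges; `8 ≤ m` absorbs the loss of 2.
  have hmt : m ≤ 5 * ((m + 1) / 2 - 2) := by omega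
  exact_mod_cast Nat.mul_le_mul_left s hmt

theorem mainTheorem8 (k : ℕ) (hk : 1 ≤ k) (hgirth : ErdosGirthConjecture k) :
    ∃ c : ℝ, 0 < c ∧ ∀ s : ℕ → ℕ,
      (fun n : ℕ => (s n : ℝ)) =o[atTop]
        (fun n : ℕ => (n : ℝ) ^ (1 / 3 - 1 / (3 * (k : ℝ)))) →
      ∀ᶠ n : ℕ in atTop,
        ENNReal.ofReal (c * (s n : ℝ) * (n : ℝ) ^ (1 + 1 / (k : ℝ))) ≤
            simultaneousComplexity (2 * k - 1) n (s n) ∧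
          ENNReal.ofReal (c * (s n : ℝ) * (n : ℝ) ^ (1 + 1 / (k : ℝ))) ≤
            expectedSimultaneousComplexity (2 * k - 1) n (s n) := by
  obtain ⟨c₀, hc₀, hgirth⟩ := hgirth
  have hk' : (1 : ℝ) ≤ k := by exact_mod_cast hk
  refine ⟨c₀ / 12, by positivity, fun s hs => ?_⟩
  -- Chosen so that 2sm ≤ n²/4, which is at most `n.choose 2` once n ≥ 2.
  have hε : (0 : ℝ) < 1 / (16 * c₀) := by positivity
  have hlarge : ∀ᶠ n : ℕ in atTop, 8 / c₀ ≤ (n : ℝ) ^ (1 + 1 / (k : ℝ)) :=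
    ((tendsto_rpow_atTop (by positivity)).comp tendsto_natCast_atTop_atTop).eventually_ge_atTop _
  filter_upwards [hgirth, hs.def hε, hlarge, eventually_ge_atTop 2] with n hGn hsn hn8 hn2
  obtain ⟨G₀, hG₀, hG₀card⟩ := hGn
  have hn2' : (2 : ℝ) ≤ n := by exact_mod_cast hn2
  set x : ℝ := (n : ℝ) ^ (1 + 1 / (k : ℝ)) with hx
  set m : ℕ := ⌈c₀ * x⌉₊ with hm
  -- The conjecture bounds the edge number only from below; packing also needs an upper bound, hence
  -- the trimming to `m` edges.
  obtain ⟨G, hGG₀, hGcard⟩ := G₀.exists_le_ncard_edgeSet_eq (m := m) (Nat.ceil_le.2 hG₀card)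
  have hG : ((2 * k + 2 : ℕ) : ℕ∞) ≤ G.egirth := hG₀.ge.trans (SimpleGraph.egirth_anti hGG₀)
  have hcx : 8 ≤ c₀ * x := by rwa [div_le_iff₀' hc₀] at hn8
  have hmx : c₀ * x ≤ m := Nat.le_ceil _
  have hm8 : 8 ≤ m := by exact_mod_cast hcx.trans hmx
  have hmx' : (m : ℝ) ≤ 2 * (c₀ * x) := by
    have := Nat.ceil_lt_add_one (show 0 ≤ c₀ * x by linarith)
    linarith
  have hsn' : (s n : ℝ) ≤ 1 / (16 * c₀) * (n : ℝ) ^ (1 - 1 / (k : ℝ)) := by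
    rw [Real.norm_of_nonneg (by positivity), Real.norm_of_nonneg (by positivity)] at hsn
    refine hsn.trans ?_
    refine mul_le_mul_of_nonneg_left (Real.rpow_le_rpow_of_exponent_le (by linarith) ?_) hε.le
    have h1 : 1 / (k : ℝ) ≤ 1 := by
      rw [div_le_one (by linarith)]
      exact hk'
    have h2 : 1 / (3 * (k : ℝ)) = 1 / 3 * (1 / k) := by ring
    rw [h2]
    linarith
  have hpow : (n : ℝ) ^ (1 - 1 / (k : ℝ)) * x = n ^ 2 := by
    rw [hx, ← Real.rpow_add (by linarith), ← Real.rpow_natCast]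
    congr 1
    push_cast
    ring
  have hsm : 2 * s n * m ≤ n.choose 2 := by
    have : (2 * s n * m : ℝ) ≤ (n.choose 2 : ℕ) := by
      rw [Nat.cast_choose_two]
      calc
        (2 * s n * m : ℝ) ≤
            2 * (1 / (16 * c₀) * (n : ℝ) ^ (1 - 1 / (k : ℝ))) * (2 * (c₀ * x)) := by gcongr
        _ = (n : ℝ) ^ (1 - 1 / (k : ℝ)) * x / 4 := by
          field_simp
          ring
        _ = n ^ 2 / 4 := by rw [hpow]
        _ ≤ _ := by nlinarith
    exact_mod_cast this
  have hexp : ENNReal.ofReal (c₀ / 12 * (s n : ℝ) * x) ≤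
      expectedSimultaneousComplexity (2 * k - 1) n (s n) := by
    have h12 : (12 : ℝ≥0∞) = ENNReal.ofReal 12 := by simp
    refine (ENNReal.mul_le_mul_iff_right (a := 12) (by norm_num) (by norm_num)).1 ?_
    refine le_trans ?_ (mul_ncard_le_expectedSimultaneousComplexity hk hG hGcard hm8 hsm)
    rw [h12, ← ENNReal.ofReal_mul (by norm_num), ← ENNReal.ofReal_natCast]
    refine ENNReal.ofReal_le_ofReal ?_
    calc
      12 * (c₀ / 12 * (s n : ℝ) * x) = s n * (c₀ * x) := by ring
      _ ≤ s n * m := by gcongr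
      _ = _ := by push_cast; rfl
  exact ⟨hexp.trans (expectedSimultaneousComplexity_le_simultaneousComplexity _ _ _), hexp⟩
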